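/- **Setting.** A configuration space $\mathcal C$ with $n$ degrees of freedom is parameterized by a box $\mathcal B=\prod_{i=1}^n[c_i^{\min},c_i^{\max}]\subset\mathbb R^n$: there is a continuous surjection $\pi:\mathcal B\to\mathcal C$ onto a metric space $(\mathcal C,d)$ that identifies only boundary points of $\mathcal B$. Any $p,q\in\mathcal C$ are joined by a chosen local path $\ell_{p,q}:[0,1]\to\mathcal C$ which is a shortest path of constant speed, i.e. $d(\ell_{p,q}(s),\ell_{p,q}(t))=|s-t|\,d(p,q)$. Let $\mathcal C_{\rm free}\subseteq\mathcal C$ be the free space and let $q_{\rm init},q_{\rm goal}\in\mathcal B$ have configurations in $\mathcal C_{\rm free}$. (Below, $q_{\rm init},q_{\rm goal}$ also denote these configurations.) **The planner.** RRT$^+$ with step size $\eta>0$ keeps a graph $G$, initially the single vertex $q_{\rm init}$, and runs through stages $0,1,\dots,L$ ($L$ arbitrary). Stage $s$ has a subspace $\mathcal C_{\rm sub}^{s}\subseteq\mathcal B$ containing $q_{\rm init}$ and $q_{\rm goal}$ (any subset, possibly random; e.g. $L=n-1$ and $\dim\mathcal C^s_{\rm sub}=s+1$). In each iteration, with $s$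 the current stage, 1. a sample $q_{\rm rand}$ is drawn from $\mathcal C_{\rm sub}^{s}$: conditionally on the history its law is $\mu(\mathcal C_{\rm sub}^{s})$, where the sampler $\mu$ assigns to a subspace a probability distribution on $\mathcal B$, concentrated on that subspace when it is one of the $\mathcal C^s_{\rm sub}$; 2. $q_{\rm near}$ is a vertex of $G$ nearest to $\pi(q_{\rm rand})$ (ties broken arbitrarily); 3. $q_{\rm new}$ is a point of the local path from $q_{\rm near}$ to $\pi(q_{\rm rand})$, at distance at most $\eta$ from $q_{\rm near}$, such that the part of the local path up to $q_{\rm new}$ lies in $\mathcal C_{\rm free}$; if the part of the local path up to distance $\eta$ (or the whole local path, if shorter) lies in $\mathcal C_{\rm free}$, then $q_{\rm new}$ is the end point of that part; 4. the vertex $q_{\rm new}$ and the edge $(q_{\rm near},q_{\rm new})$, with the part of the local path just described, are added to $G$; 5. the planner stays in its stage or passes to the next one; this decision may depend on the history and on further randomness. The last stage is not interrupted. Let $G_k$ be the graph after $k$ samples. For $\varepsilon>0$, $G_k$ *contains a solution with goal tolerance $\varepsilon$* if one can follow edges of $G_k$ from $q_{\rm init}$ to a vertex $v$ with $d(v,q_{\rm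 goal})\le\varepsilon$ such that these edges followed by the local path from $v$ to $q_{\rm goal}$ form a path in $\mathcal C_{\rm free}$ from $q_{\rm init}$ to $q_{\rm goal}$. RRT$^+$ is *probabilistically complete* if the following holds: whenever there is a continuous path from $q_{\rm init}$ to $q_{\rm goal}$ in the interior of $\mathcal C_{\rm free}$ (that is, a path with positive clearance; if $\mathcal C_{\rm free}$ is open, any path in $\mathcal C_{\rm free}$), then for every $\varepsilon>0$ the probability that $G_k$ contains a solution with goal tolerance $\varepsilon$ tends to $1$ as $k\to\infty$, and the probability that it contains none tends to $0$. (The two are stated separately, with outer probabilities, because step 2 and step 3 may make non-measurable choices.) **Theorem.** RRT$^+$ is probabilistically complete if the following conditions hold. * The subspace in the last stage is the entire configuration space: $\mathcal C_{\rm sub}^{L}=\mathcal B$. * The sampler can generate any point of the current subspace: for every $s$, every $x\in\mathcal C_{\rm sub}^{s}$ and every open $U\ni x$, $\mu(\mathcal C_{\rm sub}^{s})(U)>0$. * In each stage before the last one, almost surely only finitely many samples are generated. -/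

import Mathlib

open MeasureTheory ProbabilityTheory Filter Topology
open scoped unitInterval

namespace RRTPlanning

/-! ### Configuration spaces and planning problems -/

/-- A configuration space with `n` degrees of freedom.  Each degree of freedom is parameterized by
a compact interval, so that samples are points of the box `∏ i, [lo i, hi i]`.  The space `X` itself
is obtained from the box by identifying boundary points (as the topology of the mechanism requires);
distances and local paths live in `X`.  The local path between two configurations is a shortest
path, parameterized proportionally to arc length. -/
structure ConfigSpace (n : ℕ) (X : Type*) [MetricSpace X] where
  /-- lower bounds of the degrees of freedom -/
  lo : Fin n → ℝ
  /-- upper bounds of the degrees of freedom -/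
  hi : Fin n → ℝ
  lo_le_hi : lo ≤ hi
  /-- the configuration with given parameters -/
  point : Set.Icc lo hi → X
  continuous_point : Continuous point
  surjective_point : Function.Surjective point
  /-- only points of the boundary of the box are identified with each other -/
  boundary_of_point_eq : ∀ a b : Set.Icc lo hi, point a = point b →
    a = b ∨ ((a : Fin n → ℝ) ∈ frontier (Set.Icc lo hi) ∧
      (b : Fin n → ℝ) ∈ frontier (Set.Icc lo hi))
  /-- the local path segment from one configuration to another -/
  localPath : ∀ p q : X, Path p q
  dist_localPath : ∀ (p q : X) (s t : I),
    dist (localPath p q s) (localPath p q t) = |(s : ℝ) - t| * dist p q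

/-- The box of parameters from which samples are drawn. -/
abbrev ConfigSpace.Box {n : ℕ} {X : Type*} [MetricSpace X] (C : ConfigSpace n X) : Type :=
  Set.Icc C.lo C.hi

/-- A motion planning problem: the free space (the obstacle space is its complement), and initial
and goal configurations in the free space. -/
structure Problem {n : ℕ} {X : Type*} [MetricSpace X] (C : ConfigSpace n X) where
  free : Set X
  init : C.Box
  goal : C.Box
  init_free : C.point init ∈ free
  goal_free : C.point goal ∈ free

/-- The problem has a solution with clearance: a continuous path from the initial to the goal
configuration inside the interior of the free space.  (The path being compact, this says that
some positive distance to the obstacles is kept; if the free space is open, every continuous path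
in the free space qualifies.) -/
def Problem.RobustlyFeasible {n : ℕ} {X : Type*} [MetricSpace X] {C : ConfigSpace n X}
    (pb : Problem C) : Prop :=
  ∃ γ : Path (C.point pb.init) (C.point pb.goal), ∀ t, γ t ∈ interior pb.free

/-! ### The graph built by the planner -/

/-- A graph of configurations.  An edge records its end points and the path that is followed. -/
structure PlanGraph (X : Type*) [TopologicalSpace X] where
  verts : Set X
  edges : Set (Σ a : X, Σ b : X, Path a b)

namespace PlanGraph

variable {X : Type*} [TopologicalSpace X]

/-- The graph with the single vertex `q`. -/
def start (q : X) : PlanGraph X := ⟨{q}, ∅⟩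

/-- `G.AddVertex(q)` -/
def addVertex (G : PlanGraph X) (q : X) : PlanGraph X := ⟨insert q G.verts, G.edges⟩

/-- `G.AddEdge(a, b)`, where `e` is the path along the edge -/
def addEdge (G : PlanGraph X) {a b : X} (e : Path a b) : PlanGraph X :=
  ⟨G.verts, insert ⟨a, b, e⟩ G.edges⟩

/-- The paths that are obtained by following finitely many edges of the graph. -/
inductive IsRoute (G : PlanGraph X) : ∀ {a b : X}, Path a b → Prop
  | refl (a : X) : a ∈ G.verts → IsRoute G (Path.refl a)
  | trans {a b c : X} (γ : Path a b) (e : Path b c) :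
      IsRoute G γ → (⟨b, c, e⟩ : Σ a : X, Σ b : X, Path a b) ∈ G.edges → IsRoute G (γ.trans e)

end PlanGraph

section Planner

variable {n : ℕ} {X : Type*} [MetricSpace X] {C : ConfigSpace n X}

/-- `v` is a nearest vertex of `G` to `q` (ties may be broken in any way). -/
def IsNearestVertex (G : PlanGraph X) (q v : X) : Prop :=
  v ∈ G.verts ∧ ∀ w ∈ G.verts, dist v q ≤ dist w q

/-- The parameter on the local path from `p` to `q` at which distance `η` from `p` is reached, or
`1` if `q` is at most at distance `η`. -/
noncomputable def stepEnd (η : ℝ) (p q : X) : ℝ := if dist p q ≤ η then 1 else η / dist p q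

/-- `NewConf(near, rand)` with step size `η` may return the point of parameter `t` of the local path
from `near` to `rand`: the planner moves along the local path, at most by `η`, without collision, and
if no obstacle is met it makes the full step (up to `rand`, or by the distance `η`).  If an obstacle
is met, it may stop anywhere before the obstacle (for `t = 0`, it does not move at all). -/
def IsNewConf (pb : Problem C) (η : ℝ) (near rand : X) (t : I) : Prop :=
  (t : ℝ) ≤ stepEnd η near rand ∧
  (∀ u : I, u ≤ t → C.localPath near rand u ∈ pb.free) ∧
  ((∀ u : I, (u : ℝ) ≤ stepEnd η near rand → C.localPath near rand u ∈ pb.free) →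
    (t : ℝ) = stepEnd η near rand)

/-- The part of the local path from `near` to `rand` with parameters in `[0, t]`. -/
def segmentTo (C : ConfigSpace n X) (near rand : X) (t : I) :
    Path near (C.localPath near rand t) :=
  ((C.localPath near rand).subpath 0 t).cast (C.localPath near rand).source.symm rfl

/-- One iteration of the loop: the sample `rand` turns the graph `G` into the graph `G'`. -/
def IsIteration (pb : Problem C) (η : ℝ) (G : PlanGraph X) (rand : X) (G' : PlanGraph X) : Prop :=
  ∃ (near : X) (t : I), IsNearestVertex G rand near ∧ IsNewConf pb η near rand t ∧
    G' = (G.addVertex (C.localPath near rand t)).addEdge (segmentTo C near rand t)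

/-- The graph contains a solution with goal tolerance `ε`: following edges of the graph from the
initial configuration one gets to a vertex `v` at distance at most `ε` of the goal, and continuing
with the local path from `v` to the goal one gets a path in the free space from the initial to the
goal configuration. -/
def Solves (pb : Problem C) (ε : ℝ) (G : PlanGraph X) : Prop :=
  ∃ (v : X) (γ : Path (C.point pb.init) v), G.IsRoute γ ∧ dist v (C.point pb.goal) ≤ ε ∧
    ∀ t, (γ.trans (C.localPath v (C.point pb.goal))) t ∈ pb.free

/-! ### RRT⁺ -/

/-- RRT⁺ with step size `η` on the planning problem `pb`, as a stochastic process on the probability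
space `(Ω, P)`.  There are stages `0, …, last`, and the subspace searched in a stage contains the
initial and the goal configuration.  The subspaces may be chosen at random, and the decision that the
search in the current subspace is done may depend on the history and on further randomness.
Subspaces of any shape are allowed, and the number of stages is arbitrary; the typical case is that
of `n` stages, the subspace of stage `s` having dimension `s + 1`.
The last stage is not interrupted. -/
structure RRTPlus (pb : Problem C) (η : ℝ) {Ω : Type*} [mΩ : MeasurableSpace Ω]
    (P : Measure Ω) where
  /-- index of the last stage -/
  last : ℕ
  /-- the subspace that is searched in a given stage -/
  subspace : Fin (last + 1) → Ω → Set C.Box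
  init_mem : ∀ s ω, pb.init ∈ subspace s ω
  goal_mem : ∀ s ω, pb.goal ∈ subspace s ω
  /-- the distribution from which the sampler draws when it is given a subspace -/
  sampler : Set C.Box → ProbabilityMeasure C.Box
  /-- samples are drawn from the subspace -/
  sampler_mem : ∀ s ω, ∀ᵐ x ∂(sampler (subspace s ω) : Measure C.Box), x ∈ subspace s ω
  /-- `history k` is the information available before the `k`-th sample (`k ≥ 0`) is drawn -/
  history : Filtration ℕ mΩ
  /-- the stage to which the `k`-th sample belongs -/
  stage : ℕ → Ω → Fin (last + 1)
  measurable_stage : ∀ k, Measurable[history k] (stage k)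
  stage_zero : ∀ ω, stage 0 ω = 0
  /-- after each iteration one stays in the current stage or passes to the next one -/
  stage_succ : ∀ k ω, (stage (k + 1) ω : ℕ) = stage k ω ∨ (stage (k + 1) ω : ℕ) = stage k ω + 1
  /-- the `k`-th sample -/
  sample : ℕ → Ω → C.Box
  measurable_sample : ∀ k, Measurable[history (k + 1)] (sample k)
  /-- given the history, the `k`-th sample is drawn by the sampler for the current subspace -/
  sample_law : ∀ (k : ℕ) (A : Set C.Box), MeasurableSet A →
    P⟦sample k ⁻¹' A | history k⟧ =ᵐ[P]
      fun ω => (sampler (subspace (stage k ω) ω) : Measure C.Box).real A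
  /-- the graph after `k` samples -/
  graph : ℕ → Ω → PlanGraph X
  graph_zero : ∀ ω, graph 0 ω = PlanGraph.start (C.point pb.init)
  graph_succ : ∀ k ω, IsIteration pb η (graph k ω) (C.point (sample k ω)) (graph (k + 1) ω)

namespace RRTPlus

variable {pb : Problem C} {η : ℝ} {Ω : Type*} [MeasurableSpace Ω] {P : Measure Ω}

/-- The subspace in the last stage is the entire configuration space. -/
def LastSubspaceFull (R : RRTPlus pb η P) : Prop :=
  ∀ ω, R.subspace (Fin.last R.last) ω = Set.univ

/-- The sampler can generate any point of the current subspace: every neighbourhood of such a point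
is hit with positive probability. -/
def SamplerFull (R : RRTPlus pb η P) : Prop :=
  ∀ s ω, ∀ x ∈ R.subspace s ω, ∀ U : Set C.Box, IsOpen U → x ∈ U →
    0 < (R.sampler (R.subspace s ω) : Measure C.Box) U

/-- In each stage before the last one, only finitely many samples are generated (almost surely). -/
def FiniteStages (R : RRTPlus pb η P) : Prop :=
  ∀ s, s ≠ Fin.last R.last → ∀ᵐ ω ∂P, {k | R.stage k ω = s}.Finite

/-- Probabilistic completeness: if the problem has a solution with clearance, then, whatever the goal
tolerance, the probability of having found a solution after `k` samples tends to one.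
Since nearest vertices and new configurations may be chosen in a non-measurable way, it is also
required that the (outer) probability of not having found a solution tends to zero. -/
def ProbabilisticallyComplete (R : RRTPlus pb η P) : Prop :=
  pb.RobustlyFeasible → ∀ ε : ℝ, 0 < ε →
    Tendsto (fun k => P {ω | Solves pb ε (R.graph k ω)}) atTop (𝓝 1) ∧
    Tendsto (fun k => P {ω | ¬ Solves pb ε (R.graph k ω)}) atTop (𝓝 0)

end RRTPlus

end Planner

end RRTPlanning

namespace RRTPlanning

/-! ### Growth of the graph -/

namespace PlanGraph

variable {X : Type*} [TopologicalSpace X]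

/-! A path with clearance is covered by a finite chain of balls of radius `ρ`, consecutive centres
less than `ρ` apart, whose fourfold enlargements are free (`exists_chain`). Once the graph has a
vertex in one ball, any sample in the next ball becomes a vertex (`IsIteration.mem_verts`): the
nearest vertex is then within `3 * ρ ≤ η`, so one unobstructed step reaches the sample. Other
vertices do no harm, since they can only bring the nearest vertex closer; hence the graph inherited
from earlier stages is irrelevant.

It remains to hit the balls in order. Almost surely the last stage is entered; from then on each
nonempty open set has a fixed positive conditional probability of being sampled, so by Lévy's
conditional Borel–Cantelli lemma it is hit infinitely often (`frequently_sample_mem`). Every vertex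
is joined to the start by a free route (`FreelyReached`), so a vertex in the last ball gives a
solution. -/

theorem IsRoute.mono {G G' : PlanGraph X} (hv : G.verts ⊆ G'.verts) (he : G.edges ⊆ G'.edges)
    {a b : X} {γ : Path a b} (h : G.IsRoute γ) : G'.IsRoute γ := by
  induction h with
  | refl ha => exact .refl _ (hv ha)
  | trans γ e _ hmem ih => exact .trans γ e ih (he hmem)

end PlanGraph

theorem _root_.Path.trans_mem {X : Type*} [TopologicalSpace X] {a b c : X} {γ : Path a b}
    {γ' : Path b c} {s : Set X} (h : ∀ t, γ t ∈ s) (h' : ∀ t, γ' t ∈ s) (t : I) :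
    γ.trans γ' t ∈ s := by
  have hsub : Set.range (γ.trans γ') ⊆ s := by
    rw [Path.trans_range]
    exact Set.union_subset (Set.range_subset_iff.2 h) (Set.range_subset_iff.2 h')
  exact hsub (Set.mem_range_self t)

section Planner

variable {n : ℕ} {X : Type*} [MetricSpace X] {C : ConfigSpace n X}

/-- By constant speed, the distance left to `q` is `(1 - t) * dist p q`. -/
theorem ConfigSpace.dist_localPath_le (C : ConfigSpace n X) (p q : X) (t : I) :
    dist (C.localPath p q t) q ≤ dist p q := by
  have h := C.dist_localPath p q t 1
  rw [(C.localPath p q).target] at h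
  rw [h]
  refine mul_le_of_le_one_left dist_nonneg ?_
  rw [abs_le]
  constructor <;> simp only [Set.Icc.coe_one] <;> linarith [t.2.1, t.2.2]

theorem ConfigSpace.localPath_mem_ball (C : ConfigSpace n X) {p q x : X} {a b : ℝ}
    (hp : dist p q ≤ a) (hq : dist q x < b) (t : I) :
    C.localPath p q t ∈ Metric.ball x (a + b) := by
  rw [Metric.mem_ball]
  linarith [dist_triangle (C.localPath p q t) q x, C.dist_localPath_le p q t]

/-- Every vertex of the graph is reached by a collision-free route from the initial
configuration. -/
def FreelyReached (pb : Problem C) (G : PlanGraph X) : Prop :=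
  ∀ v ∈ G.verts, ∃ γ : Path (C.point pb.init) v, G.IsRoute γ ∧ ∀ t, γ t ∈ pb.free

theorem freelyReached_start (pb : Problem C) :
    FreelyReached pb (PlanGraph.start (C.point pb.init)) := by
  rintro v rfl
  exact ⟨Path.refl _, .refl _ rfl, fun _ => pb.init_free⟩

variable {pb : Problem C} {η : ℝ} {G G' : PlanGraph X} {q : X}

theorem IsIteration.verts_subset (h : IsIteration pb η G q G') : G.verts ⊆ G'.verts := by
  obtain ⟨near, t, -, -, rfl⟩ := h
  exact Set.subset_insert _ _

theorem IsIteration.edges_subset (h : IsIteration pb η G q G') : G.edges ⊆ G'.edges := by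
  obtain ⟨near, t, -, -, rfl⟩ := h
  exact Set.subset_insert _ _

theorem segmentTo_mem_free {near : X} {t : I} (h : IsNewConf pb η near q t) (u : I) :
    segmentTo C near q t u ∈ pb.free := by
  have hmem : segmentTo C near q t u ∈ Set.range ((C.localPath near q).subpath 0 t) :=
    Set.mem_range_self u
  rw [Path.range_subpath_of_le _ _ _ t.2.1] at hmem
  obtain ⟨w, hw, hwu⟩ := hmem
  rw [← hwu]
  exact h.2.1 w hw.2

theorem FreelyReached.iteration (hG : FreelyReached pb G) (h : IsIteration pb η G q G') :
    FreelyReached pb G' := by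
  have hv := h.verts_subset
  have he := h.edges_subset
  obtain ⟨near, t, hnear, hnew, rfl⟩ := h
  rintro v (rfl | hvG)
  · obtain ⟨γ, hγ, hfree⟩ := hG near hnear.1
    exact ⟨γ.trans (segmentTo C near q t), .trans _ _ (hγ.mono hv he) (Set.mem_insert _ _),
      Path.trans_mem hfree (segmentTo_mem_free hnew)⟩
  · obtain ⟨γ, hγ, hfree⟩ := hG v hvG
    exact ⟨γ, hγ.mono hv he, hfree⟩

/-- If the ball of radius `4 * ρ` around `y` is free, the graph has a vertex within `2 * ρ` of `y`
and the sample is within `ρ` of `y`, then the sample becomes a vertex. -/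
theorem IsIteration.mem_verts (h : IsIteration pb η G q G') {v y : X} {ρ : ℝ}
    (hη : 3 * ρ ≤ η) (hfree : Metric.ball y (4 * ρ) ⊆ pb.free) (hv : v ∈ G.verts)
    (hvy : dist v y ≤ 2 * ρ) (hq : dist q y < ρ) : q ∈ G'.verts := by
  obtain ⟨near, t, hnear, hnew, rfl⟩ := h
  -- The nearest vertex is no farther from `q` than `v` is, and `dist v q ≤ 2 * ρ + ρ`.
  have hd : dist near q ≤ 3 * ρ := by
    linarith [hnear.2 v hv, dist_triangle_right v q y]
  have hend : stepEnd η near q = 1 := if_pos (hd.trans hη)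
  have ht : t = 1 := by
    -- The local path stays within `3 * ρ` of `q`, hence in the free ball of radius `4 * ρ`, so the
    -- planner must make the full step.
    refine Subtype.ext ((hnew.2.2 fun u _ => hfree ?_).trans hend)
    simpa [show 3 * ρ + ρ = 4 * ρ by ring] using C.localPath_mem_ball hd hq u
  subst ht
  refine Set.mem_insert_iff.2 (Or.inl ?_)
  exact (C.localPath near q).target.symm

theorem FreelyReached.solves (hG : FreelyReached pb G) {v : X} {ε ρ : ℝ} (hv : v ∈ G.verts)
    (hε : ρ ≤ ε) (hfree : Metric.ball (C.point pb.goal) (4 * ρ) ⊆ pb.free)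
    (hvg : dist v (C.point pb.goal) < ρ) : Solves pb ε G := by
  obtain ⟨γ, hγ, hγfree⟩ := hG v hv
  refine ⟨v, γ, hγ, hvg.le.trans hε, Path.trans_mem hγfree fun t => hfree ?_⟩
  have hρ : 0 < ρ := dist_nonneg.trans_lt hvg
  rw [Metric.mem_ball]
  linarith [C.dist_localPath_le v (C.point pb.goal) t]

/-- A path with clearance is followed by a finite chain of small free balls. -/
theorem Problem.RobustlyFeasible.exists_chain (h : pb.RobustlyFeasible) {δ : ℝ} (hδ : 0 < δ) :
    ∃ (ρ : ℝ) (m : ℕ) (x : ℕ → X), 0 < ρ ∧ ρ ≤ δ ∧ x 0 = C.point pb.init ∧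
      x m = C.point pb.goal ∧ (∀ j, dist (x j) (x (j + 1)) < ρ) ∧
      ∀ j, Metric.ball (x j) (4 * ρ) ⊆ pb.free := by
  obtain ⟨γ, hγ⟩ := h
  obtain ⟨r, hr, hsub⟩ := (isCompact_range γ.continuous).exists_thickening_subset_open
    isOpen_interior (Set.range_subset_iff.2 hγ)
  -- With `r / 4`, balls of radius `4 * ρ` centred on the path fit into its free `r`-thickening.
  have hρ : 0 < min δ (r / 4) := lt_min hδ (by positivity)
  obtain ⟨d, hd, hdist⟩ := Metric.uniformContinuous_iff.1
    (CompactSpace.uniformContinuous_of_continuous γ.continuous) _ hρ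
  obtain ⟨m, hm⟩ := exists_nat_one_div_lt hd
  have hm0 : (0 : ℝ) < m + 1 := by positivity
  -- `projIcc` keeps the chain constant at the goal after index `m + 1`, so the bounds hold for all
  -- `j`.
  refine ⟨min δ (r / 4), m + 1, fun j => γ (Set.projIcc 0 1 zero_le_one ((j : ℝ) / (m + 1))),
    hρ, min_le_left _ _, ?_, ?_, fun j => hdist ?_, fun j => ?_⟩
  · simp [Set.projIcc_left]
  · have : (((m + 1 : ℕ) : ℝ) / (m + 1)) = 1 := by
      push_cast
      exact div_self hm0.ne'
    simp only [this, Set.projIcc_right]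
    exact γ.target
  · refine lt_of_le_of_lt ((LipschitzWith.projIcc zero_le_one).dist_le_mul _ _) ?_
    rw [Real.dist_eq, ← sub_div]
    push_cast
    rw [sub_add_cancel_left, abs_div, abs_neg, abs_one, abs_of_pos hm0, one_mul]
    exact hm
  · refine ((Metric.ball_subset_ball ?_).trans
      (Metric.ball_subset_thickening (Set.mem_range_self _) r)).trans
        (hsub.trans interior_subset)
    linarith [min_le_right δ (r / 4)]

end Planner

/-! ### Events that occur in order -/

section InOrder

variable {Ω : Type*}

/-- The event that, before time `k`, the events `E 0 ·`, …, `E (j - 1) ·` have occurred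
in this order, at increasing times. -/
def occurInOrder (E : ℕ → ℕ → Set Ω) : ℕ → ℕ → Set Ω
  | 0, _ => Set.univ
  | j + 1, k => ⋃ l < k, occurInOrder E j l ∩ E j l

theorem mem_occurInOrder_succ {E : ℕ → ℕ → Set Ω} {j k : ℕ} {ω : Ω} :
    ω ∈ occurInOrder E (j + 1) k ↔ ∃ l < k, ω ∈ occurInOrder E j l ∧ ω ∈ E j l := by
  simp [occurInOrder, and_left_comm]

theorem monotone_occurInOrder (E : ℕ → ℕ → Set Ω) (j : ℕ) : Monotone (occurInOrder E j) := by
  intro k k' hk ω hω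
  cases j with
  | zero => exact Set.mem_univ _
  | succ j =>
    obtain ⟨l, hl, h⟩ := mem_occurInOrder_succ.1 hω
    exact mem_occurInOrder_succ.2 ⟨l, hl.trans_le hk, h⟩

theorem measurableSet_occurInOrder [MeasurableSpace Ω] {E : ℕ → ℕ → Set Ω}
    (hE : ∀ j k, MeasurableSet (E j k)) (j k : ℕ) : MeasurableSet (occurInOrder E j k) := by
  induction j generalizing k with
  | zero => exact MeasurableSet.univ
  | succ j ih =>
    exact MeasurableSet.iUnion fun l => MeasurableSet.iUnion fun _ => (ih l).inter (hE j l)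

/-- Events that each recur forever can be awaited one after another; no independence is needed. -/
theorem exists_mem_occurInOrder {E : ℕ → ℕ → Set Ω} {ω : Ω}
    (h : ∀ j, ∃ᶠ k in atTop, ω ∈ E j k) (j : ℕ) : ∃ k, ω ∈ occurInOrder E j k := by
  induction j with
  | zero => exact ⟨0, Set.mem_univ _⟩
  | succ j ih =>
    obtain ⟨k, hk⟩ := ih
    obtain ⟨l, hl, hE⟩ := (frequently_atTop.1 (h j)) k
    exact ⟨l + 1, mem_occurInOrder_succ.2
      ⟨l, Nat.lt_succ_self l, monotone_occurInOrder E j hl hk, hE⟩⟩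

end InOrder

/-! ### The samples of RRT⁺ -/

namespace RRTPlus

variable {n : ℕ} {X : Type*} [MetricSpace X] {C : ConfigSpace n X} {pb : Problem C} {η : ℝ}
  {Ω : Type*} [mΩ : MeasurableSpace Ω] {P : Measure Ω}

theorem freelyReached (R : RRTPlus pb η P) (k : ℕ) (ω : Ω) :
    FreelyReached pb (R.graph k ω) := by
  induction k with
  | zero => rw [R.graph_zero]; exact freelyReached_start pb
  | succ k ih => exact ih.iteration (R.graph_succ k ω)

theorem monotone_verts (R : RRTPlus pb η P) (ω : Ω) :
    Monotone fun k => (R.graph k ω).verts :=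
  monotone_nat_of_le_succ fun k => (R.graph_succ k ω).verts_subset

/-- Almost surely, the last stage is entered. -/
theorem eventually_stage_eq_last {R : RRTPlus pb η P} (h : R.FiniteStages) :
    ∀ᵐ ω ∂P, ∀ᶠ k in atTop, R.stage k ω = Fin.last R.last := by
  have h' : ∀ᵐ ω ∂P, ∀ s, s ≠ Fin.last R.last → {k | R.stage k ω = s}.Finite :=
    ae_all_iff.2 fun s => by
      by_cases hs : s = Fin.last R.last
      · simp [hs]
      · simpa [hs] using h s hs
  filter_upwards [h'] with ω hω
  have hev : ∀ᶠ k in atTop, ∀ s, s ≠ Fin.last R.last → R.stage k ω ≠ s := by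
    -- There are finitely many stages, so the eventual statements can be combined.
    refine eventually_all.2 fun s => ?_
    by_cases hs : s = Fin.last R.last
    · simp [hs]
    · rw [← Nat.cofinite_eq_atTop]
      filter_upwards [(hω s hs).compl_mem_cofinite] with k hk _ using hk
  filter_upwards [hev] with k hk
  by_contra hne
  exact hk _ hne rfl

/-- Almost surely, every nonempty open set of parameters is hit infinitely often. -/
theorem frequently_sample_mem [IsProbabilityMeasure P] {R : RRTPlus pb η P}
    (h_last : R.LastSubspaceFull) (h_sampler : R.SamplerFull) (h_finite : R.FiniteStages)
    {U : Set C.Box} (hU : IsOpen U) (hne : U.Nonempty) :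
    ∀ᵐ ω ∂P, ∃ᶠ k in atTop, R.sample k ω ∈ U := by
  obtain ⟨x, hx⟩ := hne
  obtain ⟨ω₀⟩ : Nonempty Ω := P.nonempty_of_neZero
  -- In the last stage the subspace is the whole box, so this hitting probability depends on neither
  -- `ω` nor `k`.
  let c : ℝ := (R.sampler Set.univ : Measure C.Box).real U
  have hc0 : 0 < c := by
    have h0 := h_sampler (Fin.last R.last) ω₀ x (by rw [h_last]; trivial) U hU hx
    rw [h_last] at h0
    exact ENNReal.toReal_pos h0.ne' (measure_ne_top _ _)
  -- Shifted by one: sample `k` is known only to `history (k + 1)`, and Lévy's criterion sums the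
  -- conditional probabilities of `E (k + 1)` given `history k`. `E 0` is a filler.
  let E : ℕ → Set Ω := fun k => match k with
    | 0 => ∅
    | k + 1 => R.sample k ⁻¹' U
  have hE : ∀ k, MeasurableSet[R.history k] (E k) := fun k => match k with
    | 0 => @MeasurableSet.empty _ (R.history 0)
    | k + 1 => R.measurable_sample k hU.measurableSet
  have hlaw : ∀ᵐ ω ∂P, ∀ k, (P[(E (k + 1)).indicator (1 : Ω → ℝ) | R.history k]) ω =
      (R.sampler (R.subspace (R.stage k ω) ω) : Measure C.Box).real U :=
    ae_all_iff.2 fun k => R.sample_law k U hU.measurableSet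
  filter_upwards [ae_mem_limsup_atTop_iff P hE, hlaw, eventually_stage_eq_last h_finite]
    with ω hiff hlawω hev
  have hsum : ω ∈ limsup E atTop := by
    rw [hiff]
    simp only [hlawω]
    -- The terms eventually equal `c > 0`, so the series diverges.
    refine (not_summable_iff_tendsto_nat_atTop_of_nonneg fun k => measureReal_nonneg).1 ?_
    intro hs
    have hlim : Tendsto (fun k =>
        (R.sampler (R.subspace (R.stage k ω) ω) : Measure C.Box).real U) atTop (𝓝 c) :=
      tendsto_const_nhds.congr' <| by
        filter_upwards [hev] with k hk
        rw [hk, h_last]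
    exact hc0.ne (tendsto_nhds_unique hs.tendsto_atTop_zero hlim)
  rw [mem_limsup_iff_frequently_mem, frequently_atTop] at hsum
  refine frequently_atTop.2 fun a => ?_
  obtain ⟨b, hb, hmem⟩ := hsum (a + 1)
  obtain ⟨k, rfl⟩ : ∃ k, b = k + 1 := ⟨b - 1, by omega⟩
  exact ⟨k, by omega, hmem⟩

/-- If samples hit the balls of a chain in order, then the planner follows the chain. -/
theorem exists_vertex_near (R : RRTPlus pb η P) {ρ : ℝ} {x : ℕ → X} (hρ : 0 < ρ)
    (hη : 3 * ρ ≤ η) (hx0 : x 0 = C.point pb.init) (hx : ∀ j, dist (x j) (x (j + 1)) < ρ)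
    (hfree : ∀ j, Metric.ball (x j) (4 * ρ) ⊆ pb.free) {j k : ℕ} {ω : Ω}
    (h : ω ∈ occurInOrder
      (fun j k => R.sample k ⁻¹' (C.point ⁻¹' Metric.ball (x (j + 1)) ρ)) j k) :
    ∃ v ∈ (R.graph k ω).verts, dist v (x j) < ρ := by
  induction j generalizing k with
  | zero =>
    refine ⟨x 0, R.monotone_verts ω (Nat.zero_le k) ?_, by simpa⟩
    simp [R.graph_zero, hx0, PlanGraph.start]
  | succ j ih =>
    obtain ⟨l, hl, hj, hmem⟩ := mem_occurInOrder_succ.1 h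
    obtain ⟨v, hv, hvx⟩ := ih hj
    have hq : dist (C.point (R.sample l ω)) (x (j + 1)) < ρ := hmem
    refine ⟨_, R.monotone_verts ω (Nat.succ_le_of_lt hl)
      ((R.graph_succ l ω).mem_verts hη (hfree (j + 1)) hv ?_ hq), hq⟩
    linarith [dist_triangle v (x j) (x (j + 1)), hx j]

end RRTPlus

end RRTPlanning

/-! ### Convergence of outer probabilities and conclusion. -/

/-- `A k` may be non-measurable, so neither limit yields the other; the measurable `B k` bound `A k`
from below and, through complements, `(A k)ᶜ` from above. -/
theorem tendsto_measure_of_monotone_subset {Ω : Type*} [MeasurableSpace Ω] {P : Measure Ω}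
    [IsProbabilityMeasure P] {A B : ℕ → Set Ω} (hB : ∀ k, MeasurableSet (B k)) (hmono : Monotone B)
    (hBA : ∀ k, B k ⊆ A k) (h : ∀ᵐ ω ∂P, ∃ k, ω ∈ B k) :
    Tendsto (fun k => P (A k)) atTop (𝓝 1) ∧ Tendsto (fun k => P (A k)ᶜ) atTop (𝓝 0) := by
  have hB1 : Tendsto (fun k => P (B k)) atTop (𝓝 1) := by
    have hU : P (⋃ k, B k) = 1 := by
      rw [← measure_univ (μ := P)]
      refine measure_congr (eventuallyEq_univ.2 ?_)
      filter_upwards [h] with ω hω using Set.mem_iUnion.2 hω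
    rw [← hU]
    exact tendsto_measure_iUnion_atTop hmono
  refine ⟨tendsto_of_tendsto_of_tendsto_of_le_of_le hB1 tendsto_const_nhds
    (fun k => measure_mono (hBA k)) fun k => prob_le_one, ?_⟩
  have hB0 : Tendsto (fun k => P (B k)ᶜ) atTop (𝓝 0) := by
    simp only [fun k => prob_compl_eq_one_sub (μ := P) (hB k)]
    simpa using ENNReal.Tendsto.sub tendsto_const_nhds hB1 (Or.inl ENNReal.one_ne_top)
  exact tendsto_of_tendsto_of_tendsto_of_le_of_le tendsto_const_nhds hB0
    (fun k => zero_le) fun k => measure_mono (Set.compl_subset_compl.2 (hBA k))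

theorem mainTheorem1 {n : ℕ} {X : Type*} [MetricSpace X] {C : RRTPlanning.ConfigSpace n X}
    (pb : RRTPlanning.Problem C) (η : ℝ) (hη : 0 < η)
    {Ω : Type*} [MeasurableSpace Ω] (P : Measure Ω) [IsProbabilityMeasure P]
    (R : RRTPlanning.RRTPlus pb η P)
    (h_last : R.LastSubspaceFull) (h_sampler : R.SamplerFull) (h_finite : R.FiniteStages) :
    R.ProbabilisticallyComplete := by
  intro hfeas ε hε
  obtain ⟨ρ, m, x, hρ, hρδ, hx0, hxm, hx, hfree⟩ :=
    -- `ε` serves the goal tolerance, and `η / 3` lets a single step cover `3 * ρ`.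
    hfeas.exists_chain (δ := min ε (η / 3)) (lt_min hε (by positivity))
  have hρη : 3 * ρ ≤ η := by linarith [hρδ.trans (min_le_right ε (η / 3))]
  have hopen (j : ℕ) : IsOpen (C.point ⁻¹' Metric.ball (x (j + 1)) ρ) :=
    Metric.isOpen_ball.preimage C.continuous_point
  have hne (j : ℕ) : (C.point ⁻¹' Metric.ball (x (j + 1)) ρ).Nonempty :=
    (Metric.nonempty_ball.2 hρ).preimage C.surjective_point
  -- The index is `j + 1` because the ball around `x 0` already contains the initial vertex.
  let E : ℕ → ℕ → Set Ω :=
    fun j k => R.sample k ⁻¹' (C.point ⁻¹' Metric.ball (x (j + 1)) ρ)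
  have hE (j k : ℕ) : MeasurableSet (E j k) :=
    R.history.le (k + 1) _ (R.measurable_sample k (hopen j).measurableSet)
  refine tendsto_measure_of_monotone_subset (B := RRTPlanning.occurInOrder E m)
    (RRTPlanning.measurableSet_occurInOrder hE m) (RRTPlanning.monotone_occurInOrder E m)
    (fun k ω hω => ?_) ?_
  · obtain ⟨v, hv, hvx⟩ := R.exists_vertex_near hρ hρη hx0 hx hfree hω
    exact (R.freelyReached k ω).solves hv (hρδ.trans (min_le_left _ _))
      (hxm ▸ hfree m) (hxm ▸ hvx)
  · have hhit : ∀ᵐ ω ∂P, ∀ j, ∃ᶠ k in atTop, ω ∈ E j k := ae_all_iff.2 fun j =>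
      RRTPlanning.RRTPlus.frequently_sample_mem h_last h_sampler h_finite (hopen j) (hne j)
    filter_upwards [hhit] with ω hω using RRTPlanning.exists_mem_occurInOrder hω m
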